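/- Let $N\ge 1$, let $E_1\le\dots\le E_N$ be real numbers with $\sum_i E_i=0$, put $A=-i\,\mathrm{diag}(E_1,\dots,E_N)\in\mathfrak{su}(N)$, and let $B=(b_{ij})\in\mathfrak{su}(N)$ (a traceless skew-Hermitian complex $N\times N$ matrix). Index the roots $\alpha_{ij}$ by the pairs $(i,j)$ with $i\ne j$; the value of $\alpha_{ij}$ is $E_j-E_i$, and $\alpha_{ij}$ is positive if $i<j$. Call a root regular for $A$ if its value is nonzero and differs from the value of every other root. Let $\Gamma^+=\{(i,j): i<j,\ b_{ij}\neq 0\}$ be the set of positive roots occurring in $B$, let $\Theta^+\subseteq\Gamma^+$ be the subset of those that are regular for $A$, and let $\Omega^+=\Gamma^+\setminus\Theta^+$ be the subset of the degenerate ones. With $E_{ij}$ the matrix units, $X_{ij}=E_{ij}-E_{ji}$, $Y_{ij}=i(E_{ij}+E_{ji})$ and $B_0$ the diagonal part of $B$, split $B=B_r+B_s$, where $$B_r=B_0+\sum_{(i,j)\in\Theta^+}\bigl(\mathrm{Re}(b_{ij})X_{ij}+\mathrm{Im}(b_{ij})Y_{ij}\bigr),\qquad B_s=\sum_{(i,j)\in\Omega^+}\bigl(\mathrm{Re}(b_{ij})X_{ij}+\mathrm{Im}(b_{ij})Y_{ij}\bigr).$$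 The graph $\mathcal G_M$ of an $N\times N$ matrix $M=(m_{ij})$ has nodes $1,\dots,N$ and arcs $(i,j)$ for $m_{ij}\ne 0$. If $\mathcal G_B$ is connected and $\mathcal G_{B_r}$ is connected, then the system $$\dot X(t)=(A+u(t)B)\,X(t),\qquad X(0)=I,\qquad X(t)\in SU(N),$$ is controllable: for every $\bar X\in SU(N)$ there are $T\ge 0$ and a piecewise constant control $u:[0,T]\to\mathbb R$ such that the solution satisfies $X(T)=\bar X$. -/

import Mathlib

namespace QuantumControl

open Matrix

/-- The skew-Hermitian basis matrix `X_ij = E_ij - E_ji`. -/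
noncomputable def basisX {N : ℕ} (i j : Fin N) : Matrix (Fin N) (Fin N) ℂ :=
  Matrix.single i j 1 - Matrix.single j i 1

/-- The skew-Hermitian basis matrix `Y_ij = i (E_ij + E_ji)`. -/
noncomputable def basisY {N : ℕ} (i j : Fin N) : Matrix (Fin N) (Fin N) ℂ :=
  Complex.I • (Matrix.single i j 1 + Matrix.single j i 1)

/-- The free vector field `A = -i diag(E_1, ..., E_N)` with energy levels `E`. -/
noncomputable def drift {N : ℕ} (E : Fin N → ℝ) : Matrix (Fin N) (Fin N) ℂ :=
  (-Complex.I) • Matrix.diagonal (fun i => (E i : ℂ))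

/-- The value `E_j - E_i` of the root `α_ij` at the free Hamiltonian. The roots are indexed by the
pairs `(i, j)` with `i ≠ j`, the positive roots by the pairs with `i < j`. -/
def rootValue {N : ℕ} (E : Fin N → ℝ) (p : Fin N × Fin N) : ℝ :=
  E p.2 - E p.1

/-- The root indexed by `p` is regular for `A = drift E`: its value is nonzero and differs from the
value of every other root. -/
def IsRegularRoot {N : ℕ} (E : Fin N → ℝ) (p : Fin N × Fin N) : Prop :=
  rootValue E p ≠ 0 ∧
    ∀ q : Fin N × Fin N, q.1 ≠ q.2 → q ≠ p → rootValue E q ≠ rootValue E p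

open Classical in
/-- `Γ⁺`: the positive roots occurring in `B`. -/
noncomputable def positiveRoots {N : ℕ} (B : Matrix (Fin N) (Fin N) ℂ) :
    Finset (Fin N × Fin N) :=
  {p : Fin N × Fin N | p.1 < p.2 ∧ B p.1 p.2 ≠ 0}

open Classical in
/-- `Θ⁺`: the positive roots occurring in `B` that are regular for `A`. -/
noncomputable def regularRoots {N : ℕ} (E : Fin N → ℝ) (B : Matrix (Fin N) (Fin N) ℂ) :
    Finset (Fin N × Fin N) :=
  {p ∈ positiveRoots B | IsRegularRoot E p}

open Classical in
/-- `Ω⁺ = Γ⁺ \ Θ⁺`: the positive roots occurring in `B` that are degenerate for `A`. -/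
noncomputable def degenerateRoots {N : ℕ} (E : Fin N → ℝ) (B : Matrix (Fin N) (Fin N) ℂ) :
    Finset (Fin N × Fin N) :=
  positiveRoots B \ regularRoots E B

/-- The component `b^Re X_ij + b^Im Y_ij` of `B` along the root indexed by `p = (i, j)`. -/
noncomputable def rootComponent {N : ℕ} (B : Matrix (Fin N) (Fin N) ℂ) (p : Fin N × Fin N) :
    Matrix (Fin N) (Fin N) ℂ :=
  (B p.1 p.2).re • basisX p.1 p.2 + (B p.1 p.2).im • basisY p.1 p.2

/-- `B_r`: the diagonal part `B_0` of `B` together with its components along the regular roots. -/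
noncomputable def regularPart {N : ℕ} (E : Fin N → ℝ) (B : Matrix (Fin N) (Fin N) ℂ) :
    Matrix (Fin N) (Fin N) ℂ :=
  Matrix.diagonal B.diag + ∑ p ∈ regularRoots E B, rootComponent B p

/-- `B_s`: the components of `B` along the degenerate roots. -/
noncomputable def degeneratePart {N : ℕ} (E : Fin N → ℝ) (B : Matrix (Fin N) (Fin N) ℂ) :
    Matrix (Fin N) (Fin N) ℂ :=
  ∑ p ∈ degenerateRoots E B, rootComponent B p

/-- The oriented graph of a square matrix: the arcs are the pairs `(i, j)` with `M i j ≠ 0`. -/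
def matrixGraph {N : ℕ} (M : Matrix (Fin N) (Fin N) ℂ) : Digraph (Fin N) where
  Adj i j := M i j ≠ 0

/-- The graph of `M` is connected: any two nodes are joined by a path of arcs, traversed in either
direction. For the skew-Hermitian matrices considered here this is strong connectedness. -/
def GraphConnected {N : ℕ} (M : Matrix (Fin N) (Fin N) ℂ) : Prop :=
  (matrixGraph M).toSimpleGraphInclusive.Connected

/-- `u` is piecewise constant on `[0, T]`: off a finite set it is locally constant. -/
def PiecewiseConstant (u : ℝ → ℝ) (T : ℝ) : Prop :=
  ∃ S : Finset ℝ, ∀ t ∈ Set.Ioo 0 T, t ∉ S → ∀ᶠ s in nhds t, u s = u t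

/-- `X` is an integral curve on `[0, T]`, starting from the identity, of the control system
`X' = (A + u B) X` on `SU(N)`: it is continuous and satisfies the equation off a finite set of
times. -/
def IsIntegralCurve {N : ℕ} (A B : Matrix (Fin N) (Fin N) ℂ) (u : ℝ → ℝ) (T : ℝ)
    (X : ℝ → Matrix.specialUnitaryGroup (Fin N) ℂ) : Prop :=
  X 0 = 1 ∧ ContinuousOn X (Set.Icc 0 T) ∧
    ∃ S : Finset ℝ, ∀ t ∈ Set.Ioo 0 T, t ∉ S →
      HasDerivAt (fun s => (X s : Matrix (Fin N) (Fin N) ℂ))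
        ((A + u t • B) * (X t : Matrix (Fin N) (Fin N) ℂ)) t

/-- The set of elements of `SU(N)` that can be reached from the identity in some time `T ≥ 0` by
a piecewise constant control. -/
def reachableSet {N : ℕ} (A B : Matrix (Fin N) (Fin N) ℂ) :
    Set (Matrix.specialUnitaryGroup (Fin N) ℂ) :=
  {Z | ∃ T : ℝ, 0 ≤ T ∧ ∃ u : ℝ → ℝ, PiecewiseConstant u T ∧
    ∃ X : ℝ → Matrix.specialUnitaryGroup (Fin N) ℂ, IsIntegralCurve A B u T X ∧ X T = Z}

/-- The control system `X' = (A + u B) X`, `X(0) = I`, on `SU(N)` is controllable. -/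
def Controllable {N : ℕ} (A B : Matrix (Fin N) (Fin N) ℂ) : Prop :=
  reachableSet A B = Set.univ

/-- A skew-Hermitian matrix is the sum of its regular and its degenerate part. -/
theorem regularPart_add_degeneratePart {N : ℕ} (E : Fin N → ℝ) (B : Matrix (Fin N) (Fin N) ℂ)
    (hB : Bᴴ = -B) : B = regularPart E B + degeneratePart E B := by
  classical
  have hsub : regularRoots E B ⊆ positiveRoots B := by
    unfold regularRoots
    exact Finset.filter_subset _ _
  have hsum : regularPart E B + degeneratePart E B
      = Matrix.diagonal B.diag + ∑ p ∈ positiveRoots B, rootComponent B p := by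
    unfold regularPart degeneratePart degenerateRoots
    rw [add_assoc, ← Finset.sum_sdiff hsub]
    congr 1
    rw [add_comm]
  have hc : ∀ i j, B j i = -(starRingEnd ℂ) (B i j) := by
    intro i j
    have h := congrFun (congrFun hB j) i
    simp only [Matrix.conjTranspose_apply, Matrix.neg_apply] at h
    rw [starRingEnd_apply, h, neg_neg]
  have hcomp : ∀ p : Fin N × Fin N, rootComponent B p
      = Matrix.single p.1 p.2 (B p.1 p.2) + Matrix.single p.2 p.1 (B p.2 p.1) := by
    intro p
    ext k l
    rw [hc p.1 p.2]
    simp only [rootComponent, basisX, basisY, Matrix.add_apply, Matrix.smul_apply,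
      Matrix.sub_apply, Matrix.single_apply]
    split_ifs <;> apply Complex.ext <;> (simp; try ring)
  have hlt : ∑ p ∈ positiveRoots B, rootComponent B p
      = ∑ p : Fin N × Fin N, if p.1 < p.2 then rootComponent B p else 0 := by
    unfold positiveRoots
    rw [Finset.sum_filter]
    refine Finset.sum_congr rfl fun p _ => ?_
    by_cases h0 : B p.1 p.2 = 0
    · simp [h0, rootComponent]
    · simp [h0]
  rw [hsum, hlt, Fintype.sum_prod_type]
  ext k l
  have h1 : (∑ i : Fin N, ∑ j : Fin N,
      (if i < j then rootComponent B (i, j) else 0 : Matrix (Fin N) (Fin N) ℂ)) k l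
      = (if k < l then B k l else 0) + (if l < k then B k l else 0) := by
    have h2 : ∀ i j : Fin N,
        (if i < j then rootComponent B (i, j) else 0 : Matrix (Fin N) (Fin N) ℂ) k l
        = (if i = k then if j = l then if k < l then B k l else 0 else 0 else 0)
          + (if i = l then if j = k then if l < k then B k l else 0 else 0 else 0) := by
      intro i j
      rw [hcomp]
      clear hc hcomp hsum hlt hsub hB
      by_cases hij : i < j
      · simp only [hij, if_true, Matrix.add_apply, Matrix.single_apply]
        congr 1 <;> split_ifs <;> simp_all
      · simp only [hij, if_false, Matrix.zero_apply]
        split_ifs <;> simp_all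
    simp only [Matrix.sum_apply, h2, Finset.sum_add_distrib]
    simp
  rw [Matrix.add_apply, h1]
  rcases lt_trichotomy k l with h | h | h
  · simp [h, h.ne, h.not_gt]
  · simp [h]
  · simp [h, h.ne', h.not_gt]

end QuantumControl

/-! The reachable set contains the monoid S generated by the flows exp(t(A + uB)), t ≥ 0, so it
suffices that S is all of SU(N). A submonoid of a compact connected group that has an interior point
is the whole group (`submonoid_eq_top_of_mem_nhds`), so only an interior point is needed.

Any real Lie algebra containing A and B contains su(N) (`suAlgebra_le`): polynomials in ad_A²
isolate each regular root component of B, and brackets along walks in the connected graph of B_r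
produce the remaining roots and the diagonal.

To pass from brackets to flows, consider the span of the conjugates g(A + uB)g* with g in S. It is
stable under bracketing with each A + uB, hence contains su(N) (`suAlgebra_le_conjSpan`). A product
of flows whose differential misses some tangent direction can then be multiplied by a further flow
to raise its rank (`HasMapOfRank.exists_lt`). At maximal rank it covers su(N), and the open mapping
property gives interior (`exists_mem_nhds_of_suAlgebra_le`). -/

namespace QuantumControl

open Matrix

/-! ### The Lie algebra generated by A and B -/

/-- The skew-Hermitian matrix with entry `z` at `(i, j)` and `-z̄` at `(j, i)`. -/
noncomputable def skewSingle {N : ℕ} (i j : Fin N) (z : ℂ) : Matrix (Fin N) (Fin N) ℂ :=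
  Matrix.single i j z - Matrix.single j i (star z)

/-- A real subspace of matrices that is closed under commutators. -/
def BracketClosed {N : ℕ} (L : Submodule ℝ (Matrix (Fin N) (Fin N) ℂ)) : Prop :=
  ∀ X ∈ L, ∀ Y ∈ L, X * Y - Y * X ∈ L

/-- The traceless skew-Hermitian matrices. -/
def suAlgebra (N : ℕ) : Submodule ℝ (Matrix (Fin N) (Fin N) ℂ) where
  carrier := {X | Xᴴ = -X ∧ X.trace = 0}
  add_mem' := by
    rintro X Y ⟨hX, hX'⟩ ⟨hY, hY'⟩
    refine ⟨?_, ?_⟩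
    · rw [conjTranspose_add, hX, hY, neg_add]
    · rw [trace_add, hX', hY', add_zero]
  zero_mem' := by simp
  smul_mem' := by
    rintro c X ⟨hX, hX'⟩
    refine ⟨?_, ?_⟩
    · rw [conjTranspose_smul, hX, star_trivial, smul_neg]
    · rw [trace_smul, hX', smul_zero]

variable {N : ℕ} {E : Fin N → ℝ} {B : Matrix (Fin N) (Fin N) ℂ}
  {L : Submodule ℝ (Matrix (Fin N) (Fin N) ℂ)}

theorem apply_eq_neg_star {M : Matrix (Fin N) (Fin N) ℂ} (hM : Mᴴ = -M) (i j : Fin N) :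
    M j i = -star (M i j) := by
  have h := congrFun (congrFun hM j) i
  rw [conjTranspose_apply, Matrix.neg_apply] at h
  rw [h, neg_neg]

theorem drift_mem_suAlgebra (hE : ∑ i, E i = 0) : drift E ∈ suAlgebra N := by
  refine ⟨?_, ?_⟩
  · ext i j
    simp only [drift, conjTranspose_apply, Matrix.smul_apply, diagonal_apply, Matrix.neg_apply]
    by_cases h : i = j
    · subst h; simp
    · simp [h, Ne.symm h]
  · rw [drift, trace_smul, trace_diagonal, ← Complex.ofReal_sum, hE]
    simp

theorem drift_commutator_apply (M : Matrix (Fin N) (Fin N) ℂ) (k l : Fin N) :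
    (drift E * M - M * drift E) k l = Complex.I * (rootValue E (k, l) : ℂ) * M k l := by
  simp only [drift, Matrix.sub_apply, smul_mul_assoc, mul_smul_comm, Matrix.smul_apply,
    diagonal_mul, mul_diagonal, smul_eq_mul, rootValue]
  push_cast
  ring

/-- Real polynomials in `ad_A ^ 2` act on matrix entries by their values at the squared roots. -/
theorem prod_sub_sq_mul_mem (hL : BracketClosed L) (hA : drift E ∈ L) (s : Finset ℝ)
    {M : Matrix (Fin N) (Fin N) ℂ} (hM : M ∈ L) :
    Matrix.of (fun k l => ((∏ c ∈ s, (c - rootValue E (k, l) ^ 2) : ℝ) : ℂ) * M k l) ∈ L := by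
  classical
  induction s using Finset.induction_on with
  | empty => convert hM using 1; ext; simp
  | insert c s hc ih =>
    have h1 := hL _ hA _ (hL _ hA _ ih)
    convert L.add_mem h1 (L.smul_mem c ih) using 1
    ext k l
    rw [Matrix.add_apply, drift_commutator_apply, drift_commutator_apply, Matrix.smul_apply, of_apply,
      of_apply, Finset.prod_insert hc, Complex.real_smul]
    push_cast
    linear_combination (-(rootValue E (k, l) : ℂ) ^ 2 *
      (∏ c ∈ s, ((c : ℂ) - (rootValue E (k, l) : ℂ) ^ 2)) *
      M k l) * Complex.I_sq

theorem skewSingle_swap (i j : Fin N) (z : ℂ) : skewSingle i j z = skewSingle j i (-star z) := by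
  rw [skewSingle, skewSingle, star_neg, star_star, ← Matrix.single_neg, ← Matrix.single_neg]
  abel

theorem skewSingle_add (i j : Fin N) (z w : ℂ) :
    skewSingle i j (z + w) = skewSingle i j z + skewSingle i j w := by
  simp only [skewSingle, star_add, single_add]
  abel

theorem smul_skewSingle (i j : Fin N) (r : ℝ) (z : ℂ) :
    r • skewSingle i j z = skewSingle i j (r * z) := by
  simp [skewSingle, smul_sub, smul_single]

theorem skewSingle_commutator {i j k : Fin N} (hij : i ≠ j) (hjk : j ≠ k) (hik : i ≠ k) (z w : ℂ) :
    skewSingle i j z * skewSingle j k w - skewSingle j k w * skewSingle i j z =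
      skewSingle i k (z * w) := by
  simp [skewSingle, sub_mul, mul_sub, hij, hjk, hik, hij.symm, hjk.symm, hik.symm, mul_comm]

theorem drift_commutator_skewSingle (i j : Fin N) (z : ℂ) :
    drift E * skewSingle i j z - skewSingle i j z * drift E =
      skewSingle i j (Complex.I * (rootValue E (i, j) : ℂ) * z) := by
  ext k l
  rw [drift_commutator_apply]
  simp only [skewSingle, Matrix.sub_apply, single_apply, rootValue]
  split_ifs with h1 h2 h2
  · obtain ⟨rfl, rfl⟩ := h1
    obtain ⟨rfl, h⟩ := h2
    simp
  · obtain ⟨rfl, rfl⟩ := h1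
    simp
  · obtain ⟨rfl, rfl⟩ := h2
    simp
    ring
  · simp

/-- Bracketing with A multiplies the entry by i times the root value, so b and its image span ℂ over
ℝ. -/
theorem skewSingle_mem_of_ne_zero (hL : BracketClosed L) (hA : drift E ∈ L) {i j : Fin N}
    (hv : rootValue E (i, j) ≠ 0) {b : ℂ} (hb : b ≠ 0) (h : skewSingle i j b ∈ L) (z : ℂ) :
    skewSingle i j z ∈ L := by
  have h1 := hL _ hA _ h
  rw [drift_commutator_skewSingle] at h1
  have h2 := L.add_mem (L.smul_mem (z / b).re h)
    (L.smul_mem ((z / b).im / rootValue E (i, j)) h1)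
  rw [smul_skewSingle, smul_skewSingle, ← skewSingle_add] at h2
  convert h2 using 2
  have hv' : (rootValue E (i, j) : ℂ) ≠ 0 := by exact_mod_cast hv
  have h3 : z = ((z / b).re + (z / b).im * Complex.I) * b := by
    rw [Complex.re_add_im, div_mul_cancel₀ _ hb]
  push_cast
  conv_lhs => rw [h3]
  field_simp

theorem rootValue_swap (i j : Fin N) : rootValue E (j, i) = -rootValue E (i, j) := by
  simp [rootValue]

/-- By regularity, the only positions whose squared root value equals that of (i, j) are (i, j) and
(j, i). A polynomial in ad_A² vanishing at all other squared values therefore leaves a nonzero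
multiple of this root component of B. -/
theorem skewSingle_mem_of_regular (hL : BracketClosed L) (hA : drift E ∈ L) (hBL : B ∈ L)
    (hB : Bᴴ = -B) {p : Fin N × Fin N} (hp : p ∈ regularRoots E B) (z : ℂ) :
    skewSingle p.1 p.2 z ∈ L := by
  classical
  obtain ⟨i, j⟩ := p
  simp only [regularRoots, positiveRoots, Finset.mem_filter, Finset.mem_univ, true_and] at hp
  obtain ⟨⟨hij, hb⟩, hv, hreg⟩ := hp
  set v := rootValue E (i, j) with hvdef
  -- Diagonal pairs are included, so 0 lies in `s` and the diagonal of B is removed too.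
  set s : Finset ℝ :=
    (Finset.univ.image fun q : Fin N × Fin N => rootValue E q ^ 2).erase (v ^ 2) with hs
  have h1 := prod_sub_sq_mul_mem hL hA s hBL
  set c : ℝ := ∏ c ∈ s, (c - v ^ 2) with hc
  have hc0 : c ≠ 0 := by
    rw [hc, Finset.prod_ne_zero_iff]
    intro a ha
    exact sub_ne_zero.2 (Finset.ne_of_mem_erase ha)
  have hBji := apply_eq_neg_star hB i j
  have hzero : ∀ k l, (k, l) ≠ (i, j) → (k, l) ≠ (j, i) →
      ∏ c ∈ s, (c - rootValue E (k, l) ^ 2) = 0 := by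
    intro k l hkl hkl'
    refine Finset.prod_eq_zero (i := rootValue E (k, l) ^ 2) ?_ (sub_self _)
    refine Finset.mem_erase.2 ⟨fun h => ?_, Finset.mem_image_of_mem _ (Finset.mem_univ _)⟩
    have hne : k ≠ l := by
      rintro rfl
      simp only [rootValue, sub_self] at h
      exact hv (by simpa using h.symm)
    rcases sq_eq_sq_iff_eq_or_eq_neg.1 h with h | h
    · exact hreg (k, l) hne hkl h
    · refine hreg (l, k) hne.symm (fun h' => hkl' ?_) ?_
      · rw [Prod.mk.injEq] at h' ⊢
        exact ⟨h'.2, h'.1⟩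
      · rw [rootValue_swap, h, neg_neg]
  have h2 : Matrix.of (fun k l => ((∏ c ∈ s, (c - rootValue E (k, l) ^ 2) : ℝ) : ℂ) * B k l) =
      skewSingle i j ((c : ℂ) * B i j) := by
    ext k l
    rw [of_apply, skewSingle, Matrix.sub_apply, single_apply, single_apply]
    by_cases h : (k, l) = (i, j)
    · obtain ⟨rfl, rfl⟩ := Prod.mk.inj h
      simp [hij.ne, hij.ne', hc, hvdef]
    · by_cases h' : (k, l) = (j, i)
      · obtain ⟨rfl, rfl⟩ := Prod.mk.inj h'
        rw [rootValue_swap, neg_sq, ← hvdef, ← hc, hBji]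
        simp [hij.ne, hij.ne']
      · rw [hzero k l h h']
        rw [Prod.mk.injEq] at h h'
        rw [if_neg (fun h1 => h ⟨h1.1.symm, h1.2.symm⟩),
          if_neg (fun h1 => h' ⟨h1.1.symm, h1.2.symm⟩)]
        simp
  rw [h2] at h1
  exact skewSingle_mem_of_ne_zero hL hA hv (mul_ne_zero (by exact_mod_cast hc0) hb) h1 z

theorem exists_regularRoot_of_regularPart_ne_zero {i j : Fin N} (hij : i ≠ j)
    (h : regularPart E B i j ≠ 0) :
    ∃ p ∈ regularRoots E B, p = (i, j) ∨ p = (j, i) := by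
  classical
  rw [regularPart, Matrix.add_apply, diagonal_apply_ne _ hij, zero_add, Matrix.sum_apply] at h
  obtain ⟨p, hp, hne⟩ := Finset.exists_ne_zero_of_sum_ne_zero h
  refine ⟨p, hp, ?_⟩
  by_contra! hcon
  apply hne
  obtain ⟨k, l⟩ := p
  have h1 : ¬(k = i ∧ l = j) := fun h' => hcon.1 (by rw [h'.1, h'.2])
  have h2 : ¬(l = i ∧ k = j) := fun h' => hcon.2 (by rw [h'.1, h'.2])
  simp [rootComponent, basisX, basisY, h1, h2]

/-- Induction on a walk in the graph of B_r: its arcs are regular roots, and the bracket of the (a,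
b) and (b, c) planes fills the (a, c) plane. -/
theorem skewSingle_mem (hL : BracketClosed L) (hA : drift E ∈ L) (hBL : B ∈ L)
    (hB : Bᴴ = -B) (hG : GraphConnected (regularPart E B)) {i j : Fin N} (hij : i ≠ j) (z : ℂ) :
    skewSingle i j z ∈ L := by
  have hadj : ∀ k l, (matrixGraph (regularPart E B)).toSimpleGraphInclusive.Adj k l →
      ∀ z, skewSingle k l z ∈ L := by
    intro k l h z
    obtain ⟨hkl, h⟩ := h
    have : ∃ p ∈ regularRoots E B, p = (k, l) ∨ p = (l, k) := by
      rcases h with h | h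
      · exact exists_regularRoot_of_regularPart_ne_zero hkl h
      · obtain ⟨p, hp, h'⟩ := exists_regularRoot_of_regularPart_ne_zero hkl.symm h
        exact ⟨p, hp, h'.symm⟩
    obtain ⟨p, hp, rfl | rfl⟩ := this
    · exact skewSingle_mem_of_regular hL hA hBL hB hp z
    · rw [skewSingle_swap]
      exact skewSingle_mem_of_regular hL hA hBL hB hp _
  have key : ∀ k l, (matrixGraph (regularPart E B)).toSimpleGraphInclusive.Walk k l →
      k ≠ l → ∀ z, skewSingle k l z ∈ L := by
    intro k l w
    induction w with
    | nil => exact fun h => absurd rfl h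
    | @cons a b c h w ih =>
      intro hac z
      by_cases hbc : b = c
      · subst hbc
        exact hadj _ _ h z
      · rw [← one_mul z, ← skewSingle_commutator h.ne hbc hac]
        exact hL _ (hadj _ _ h _) _ (ih hbc _)
  obtain ⟨w⟩ := hG.preconnected i j
  exact key i j w hij z

/-- The bracket of X_ij and Y_ij is 2i(E_ii - E_jj). -/
theorem diagonal_sub_mem (hL : BracketClosed L) {i j : Fin N} (hij : i ≠ j)
    (h : ∀ z, skewSingle i j z ∈ L) (r : ℝ) :
    Matrix.single i i (r * Complex.I) - Matrix.single j j (r * Complex.I) ∈ L := by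
  have h1 := L.smul_mem (r / 2) (hL _ (h 1) _ (h Complex.I))
  convert h1 using 1
  simp only [skewSingle, sub_mul, mul_sub, single_mul_single_same,
    single_mul_single_of_ne _ _ _ _ hij,
    single_mul_single_of_ne _ _ _ _ hij.symm, smul_sub, smul_single, Complex.real_smul]
  simp [← sub_eq_zero]
  ext k l
  simp [single_apply]
  split_ifs <;> ring

theorem ite_half_smul_skewSingle_apply {M : Matrix (Fin N) (Fin N) ℂ} (hM : Mᴴ = -M)
    (a b k l : Fin N) :
    (if k = l then 0 else (1 / 2 : ℝ) • skewSingle k l (M k l)) a b =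
      (if k = a then if l = b then (if a = b then 0 else M a b / 2) else 0 else 0) +
      (if k = b then if l = a then (if a = b then 0 else M a b / 2) else 0 else 0) := by
  by_cases hkl : k = l
  · subst hkl
    clear hM
    simp only [if_true, Matrix.zero_apply]
    split_ifs <;> simp_all
  · rw [if_neg hkl, Matrix.smul_apply, skewSingle, Matrix.sub_apply, single_apply, single_apply,
      ← neg_neg (star (M k l)), ← apply_eq_neg_star hM]
    clear hM
    by_cases h1 : k = a ∧ l = b
    · obtain ⟨rfl, rfl⟩ := h1
      simp [hkl, Ne.symm hkl, Complex.real_smul]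
      ring
    · by_cases h2 : l = a ∧ k = b
      · obtain ⟨rfl, rfl⟩ := h2
        simp [hkl, Ne.symm hkl, Complex.real_smul]
        ring
      · rw [if_neg h1, if_neg h2, ← ite_and, if_neg h1, ← ite_and, if_neg (fun h => h2 h.symm)]
        simp

/-- A real Lie algebra of matrices containing `A` and `B` contains `su(N)`. -/
theorem suAlgebra_le (hL : BracketClosed L) (hA : drift E ∈ L) (hBL : B ∈ L)
    (hB : Bᴴ = -B) (hG : GraphConnected (regularPart E B)) : suAlgebra N ≤ L := by
  classical
  rintro M ⟨hM, hM'⟩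
  have hs := fun {i j : Fin N} (hij : i ≠ j) => skewSingle_mem hL hA hBL hB hG hij
  obtain ⟨o⟩ := hG.nonempty
  have hc := apply_eq_neg_star hM
  have hd : ∀ k, M k k = ((M k k).im : ℂ) * Complex.I := by
    intro k
    have h := congrArg Complex.re (hc k k)
    simp at h
    apply Complex.ext
    · simp; linarith
    · simp
  -- The diagonal is expanded in differences with a fixed node `o`; the terms at `o` add up to the
  -- trace, which is zero.
  have hdiag : ∑ k, (Matrix.single k k ((M k k).im * Complex.I) -
      Matrix.single o o ((M k k).im * Complex.I)) ∈ L := by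
    refine L.sum_mem fun k _ => ?_
    by_cases hk : k = o
    · subst hk; simp
    · exact diagonal_sub_mem hL hk (hs hk) _
  -- The factor 1/2 compensates for each unordered pair occurring in both orders.
  have hoff : ∑ k, ∑ l, (if k = l then 0 else (1 / 2 : ℝ) • skewSingle k l (M k l)) ∈ L := by
    refine L.sum_mem fun k _ => L.sum_mem fun l _ => ?_
    split_ifs with h
    · exact L.zero_mem
    · exact L.smul_mem _ (hs h _)
  convert L.add_mem hdiag hoff using 1
  have h0 : ∑ k, Matrix.single o o (((M k k).im : ℂ) * Complex.I) = 0 := by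
    have : ∑ k, (((M k k).im : ℂ) * Complex.I) = 0 := by
      rw [← hM', trace]
      exact Finset.sum_congr rfl fun k _ => (hd k).symm
    have h' := map_sum (Matrix.singleAddMonoidHom (α := ℂ) o o)
      (fun k => (((M k k).im : ℂ) * Complex.I)) Finset.univ
    rw [this, map_zero] at h'
    exact h'.symm
  rw [Finset.sum_sub_distrib, h0, sub_zero]
  ext a b
  simp only [Matrix.add_apply, Matrix.sum_apply, ← hd]
  simp only [ite_half_smul_skewSingle_apply hM, Finset.sum_add_distrib]
  by_cases hab : a = b
  · subst hab
    simp [single_apply]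
  · simp [single_apply, hab]
    rw [Finset.sum_eq_zero]
    · rintro k -
      rw [if_neg]
      rintro ⟨rfl, rfl⟩
      exact hab rfl

end QuantumControl

/-! ### Compactness and connectedness of SU(N), and exponentials of su(N) -/

namespace QuantumControl

open Matrix

section Topology

open scoped Matrix.Norms.L2Operator

variable {N : ℕ}

instance : IsTopologicalGroup (specialUnitaryGroup (Fin N) ℂ) where
  continuous_inv := by
    refine Continuous.subtype_mk ?_ _
    exact continuous_subtype_val.star

instance : CompactSpace (specialUnitaryGroup (Fin N) ℂ) := by
  refine isCompact_iff_compactSpace.1 ?_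
  have : ProperSpace (Matrix (Fin N) (Fin N) ℂ) := FiniteDimensional.proper ℂ _
  refine Metric.isCompact_of_isClosed_isBounded ?_ ?_
  · have h : ((specialUnitaryGroup (Fin N) ℂ : Submonoid (Matrix (Fin N) (Fin N) ℂ)) :
        Set (Matrix (Fin N) (Fin N) ℂ)) =
        {M | star M * M = 1} ∩ {M | M.det = 1} := by
      ext M
      rw [SetLike.mem_coe, mem_specialUnitaryGroup_iff, mem_unitaryGroup_iff']
      rfl
    rw [h]
    exact (isClosed_eq (by fun_prop) continuous_const).inter
      (isClosed_eq (Continuous.matrix_det continuous_id) continuous_const)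
  · refine (Metric.isBounded_closedBall (x := 0) (r := 1)).subset fun M hM => ?_
    rw [mem_closedBall_zero_iff]
    rcases subsingleton_or_nontrivial (Matrix (Fin N) (Fin N) ℂ) with h | h
    · rw [Subsingleton.elim M 0, norm_zero]
      exact zero_le_one
    · exact (CStarRing.norm_of_mem_unitary (mem_specialUnitaryGroup_iff.1 hM).1).le

theorem exists_neg_exp_notMem_spectrum (u : Matrix (Fin N) (Fin N) ℂ) :
    ∃ θ : ℝ, -Complex.exp (Complex.I * θ) ∉ spectrum ℂ u := by
  by_contra! h
  refine Set.infinite_of_injOn_mapsTo (f := fun θ : ℝ => -Complex.exp (Complex.I * θ)) ?_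
    (fun θ _ => h θ) (Set.Icc_infinite Real.pi_pos) u.finite_spectrum
  intro a ha b hb hab
  refine Real.injOn_cos ha hb ?_
  have h1 := congrArg Complex.re hab
  simpa [mul_comm Complex.I, Complex.exp_ofReal_mul_I_re] using h1

/-- A scalar e^{iθ} with -e^{iθ} outside the spectrum of u is at distance less than 2 from u, hence
joined to u; and e^{iθ} is joined to 1 through an exponential path. -/
instance : ConnectedSpace (unitary (Matrix (Fin N) (Fin N) ℂ)) := by
  suffices h : ∀ u : unitary (Matrix (Fin N) (Fin N) ℂ), Joined 1 u by
    have : PathConnectedSpace (unitary (Matrix (Fin N) (Fin N) ℂ)) :=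
      ⟨⟨1⟩, fun u v => (h u).symm.trans (h v)⟩
    infer_instance
  intro u
  obtain ⟨θ, hθ⟩ := exists_neg_exp_notMem_spectrum (u : Matrix (Fin N) (Fin N) ℂ)
  let x : selfAdjoint (Matrix (Fin N) (Fin N) ℂ) := ⟨algebraMap ℂ _ (θ : ℂ), by
    rw [selfAdjoint.mem_iff, ← algebraMap_star_comm]; simp⟩
  set e : unitary (Matrix (Fin N) (Fin N) ℂ) := selfAdjoint.expUnitary x with he
  have hx : (e : Matrix (Fin N) (Fin N) ℂ) = algebraMap ℂ _ (Complex.exp (Complex.I * θ)) := by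
    rw [he, selfAdjoint.expUnitary_coe, Complex.exp_eq_exp_ℂ, NormedSpace.algebraMap_exp_comm,
      map_mul, Algebra.smul_def]
  refine (selfAdjoint.joined_one_expUnitary x).trans (Unitary.joined _ _ ?_)
  rw [Unitary.norm_sub_eq, Unitary.norm_sub_one_lt_two_iff (Subtype.prop _), ← he]
  rw [spectrum.notMem_iff] at hθ ⊢
  convert hθ.mul (Unitary.toUnits (star e)).isUnit using 1
  have h1 : (e : Matrix (Fin N) (Fin N) ℂ) * star (e : Matrix (Fin N) (Fin N) ℂ) = 1 :=
    Unitary.coe_mul_star_self e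
  rw [map_neg, map_neg, map_one, ← hx]
  simp [sub_mul, h1]

/-- SU(N) is a continuous retract of U(N): one row is multiplied by the conjugate of the
determinant. -/
instance : PreconnectedSpace (specialUnitaryGroup (Fin N) ℂ) := by
  rcases isEmpty_or_nonempty (Fin N) with hN | ⟨⟨o⟩⟩
  · have : Subsingleton (Matrix (Fin N) (Fin N) ℂ) := inferInstance
    infer_instance
  let d : Matrix (Fin N) (Fin N) ℂ → Matrix (Fin N) (Fin N) ℂ := fun g =>
    diagonal (Function.update 1 o (star g.det))
  have hd1 : ∀ g : Matrix (Fin N) (Fin N) ℂ, (d g).det = star g.det := by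
    intro g
    simp only [d, det_diagonal]
    rw [Finset.prod_update_of_mem (Finset.mem_univ o)]
    simp
  have hdet : ∀ g : unitary (Matrix (Fin N) (Fin N) ℂ),
      star (g : Matrix (Fin N) (Fin N) ℂ).det * (g : Matrix (Fin N) (Fin N) ℂ).det = 1 := by
    intro g
    have h := congrArg det (Unitary.coe_star_mul_self g)
    rwa [det_mul, star_eq_conjTranspose, det_conjTranspose, det_one] at h
  have hd2 : ∀ g : unitary (Matrix (Fin N) (Fin N) ℂ),
      d g ∈ unitary (Matrix (Fin N) (Fin N) ℂ) := by
    intro g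
    refine mem_unitaryGroup_iff'.2 ?_
    rw [star_eq_conjTranspose, diagonal_conjTranspose, diagonal_mul_diagonal, ← diagonal_one]
    congr 1
    ext i
    rw [Pi.star_apply]
    by_cases hi : i = o
    · subst hi
      rw [Function.update_self, star_star, mul_comm, hdet]
    · simp [Function.update_of_ne hi]
  let f : unitary (Matrix (Fin N) (Fin N) ℂ) → specialUnitaryGroup (Fin N) ℂ := fun g =>
    ⟨d g * g, mem_specialUnitaryGroup_iff.2
      ⟨mul_mem (hd2 g) g.2, by rw [det_mul, hd1, hdet]⟩⟩
  have hf : Continuous f := by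
    refine Continuous.subtype_mk (Continuous.mul ?_ continuous_subtype_val) _
    refine Continuous.matrix_diagonal ?_
    exact continuous_const.update o (continuous_subtype_val.matrix_det.star)
  have hsurj : Function.Surjective f := by
    rintro ⟨g, hg⟩
    refine ⟨⟨g, (mem_specialUnitaryGroup_iff.1 hg).1⟩, Subtype.ext ?_⟩
    have h : d g = 1 := by
      simp only [d, (mem_specialUnitaryGroup_iff.1 hg).2, star_one]
      rw [← Pi.one_apply (M := fun _ : Fin N => ℂ) o, Function.update_eq_self]
      exact diagonal_one
    change d g * g = g
    rw [h, one_mul]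
  refine ⟨?_⟩
  rw [← hsurj.range_eq]
  exact isPreconnected_range hf

/-- The matrix iX is Hermitian, so X is unitarily diagonalizable and the formula reduces to diagonal
matrices. -/
theorem det_exp_of_skewHermitian {X : Matrix (Fin N) (Fin N) ℂ} (hX : Xᴴ = -X) :
    (NormedSpace.exp X).det = Complex.exp X.trace := by
  have hH : (Complex.I • X).IsHermitian := by
    rw [IsHermitian, conjTranspose_smul, hX]
    simp
  obtain ⟨U, D, h1⟩ : ∃ (U : unitary (Matrix (Fin N) (Fin N) ℂ)) (D : Fin N → ℂ),
      Complex.I • X = (U : Matrix (Fin N) (Fin N) ℂ) * diagonal D *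
        (star U : Matrix (Fin N) (Fin N) ℂ) :=
    ⟨hH.eigenvectorUnitary, _, hH.spectral_theorem⟩
  have h2 : X = ((Unitary.toUnits U : (Matrix (Fin N) (Fin N) ℂ)ˣ) : Matrix (Fin N) (Fin N) ℂ) *
      diagonal (-Complex.I • D) *
        ((Unitary.toUnits U)⁻¹ : (Matrix (Fin N) (Fin N) ℂ)ˣ) := by
    calc X = -Complex.I • (Complex.I • X) := by rw [smul_smul]; simp
      _ = _ := by
        rw [h1, diagonal_smul, mul_smul_comm, smul_mul_assoc]
        rfl
  rw [h2, Matrix.exp_units_conj, det_units_conj, Matrix.exp_diagonal, det_diagonal,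
    trace_units_conj, trace_diagonal, Complex.exp_sum]
  refine Finset.prod_congr rfl fun i _ => ?_
  rw [Pi.coe_exp, Complex.exp_eq_exp_ℂ]

theorem exp_mem_specialUnitaryGroup {X : Matrix (Fin N) (Fin N) ℂ} (hX : X ∈ suAlgebra N) :
    NormedSpace.exp X ∈ specialUnitaryGroup (Fin N) ℂ := by
  rw [mem_specialUnitaryGroup_iff]
  have : NormedAlgebra ℚ (Matrix (Fin N) (Fin N) ℂ) := .restrictScalars ℚ ℂ _
  exact ⟨NormedSpace.exp_mem_unitary_of_mem_skewAdjoint hX.1, by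
    rw [det_exp_of_skewHermitian hX.1, hX.2, Complex.exp_zero]⟩

end Topology

end QuantumControl

/-! ### Submonoids of compact groups, and conjugates of the control fields -/

namespace QuantumControl

open Matrix Filter Topology

/-- By compactness the powers gⁿ accumulate at g⁻¹, so for some n the submonoid is a neighbourhood
of (gⁿ)⁻¹; translating by gⁿ moves this neighbourhood to 1. -/
theorem submonoid_mem_nhds_one {G : Type*} [Group G] [TopologicalSpace G]
    [IsTopologicalGroup G] [CompactSpace G] {S : Submonoid G} {g : G} (h : (S : Set G) ∈ 𝓝 g) :
    (S : Set G) ∈ 𝓝 (1 : G) := by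
  have hg : g ∈ S := mem_of_mem_nhds h
  have h1 : {x : G | (S : Set G) ∈ 𝓝 x⁻¹} ∈ 𝓝 g⁻¹ := by
    have : Tendsto (fun x : G => x⁻¹) (𝓝 g⁻¹) (𝓝 g) := by
      simpa using (continuous_inv (G := G)).tendsto g⁻¹
    exact this.eventually (eventually_eventually_nhds.2 h)
  have h2 := mapClusterPt_self_zpow_atTop_pow g (-1)
  rw [_root_.zpow_neg_one] at h2
  obtain ⟨n, hn⟩ := (h2.frequently h1).exists
  have h3 : Tendsto (fun y : G => (g ^ n)⁻¹ * y) (𝓝 1) (𝓝 (g ^ n)⁻¹) := by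
    simpa using (continuous_const_mul (g ^ n)⁻¹).tendsto 1
  filter_upwards [h3 hn] with y hy
  have := S.mul_mem (S.pow_mem hg n) hy
  simpa using this

/-- A submonoid that is a neighbourhood of 1 is open and closed by translation. -/
theorem submonoid_eq_top_of_mem_nhds {G : Type*} [Group G] [TopologicalSpace G]
    [IsTopologicalGroup G] [CompactSpace G] [PreconnectedSpace G] {S : Submonoid G} {g : G}
    (h : (S : Set G) ∈ 𝓝 g) : S = ⊤ := by
  have h1 := submonoid_mem_nhds_one h
  refine SetLike.coe_injective (IsClopen.eq_univ ⟨?_, ?_⟩ ⟨1, S.one_mem⟩)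
  · refine isClosed_of_closure_subset fun y hy => ?_
    have h3 : Tendsto (fun z : G => z⁻¹ * y) (𝓝 y) (𝓝 1) := by
      simpa using (show Continuous fun z : G => z⁻¹ * y by fun_prop).tendsto y
    obtain ⟨z, hz, hz'⟩ := mem_closure_iff_nhds.1 hy _ (h3 h1)
    simpa using S.mul_mem hz' hz
  · refine isOpen_iff_mem_nhds.2 fun s hs => ?_
    have h3 : Tendsto (fun y : G => s⁻¹ * y) (𝓝 s) (𝓝 1) := by
      simpa using (continuous_const_mul s⁻¹).tendsto s
    filter_upwards [h3 h1] with y hy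
    simpa using S.mul_mem hs hy

section Orbit

variable {N : ℕ} {S : Submonoid (Matrix (Fin N) (Fin N) ℂ)} {D : Set (Matrix (Fin N) (Fin N) ℂ)}

/-- The real span of the conjugates of the elements of `D` by the elements of `S`. -/
noncomputable def conjSpan (S : Submonoid (Matrix (Fin N) (Fin N) ℂ))
    (D : Set (Matrix (Fin N) (Fin N) ℂ)) : Submodule ℝ (Matrix (Fin N) (Fin N) ℂ) :=
  Submodule.span ℝ {M | ∃ g ∈ S, ∃ C ∈ D, M = g * C * star g}

theorem subset_conjSpan : D ⊆ conjSpan S D := fun C hC =>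
  Submodule.subset_span ⟨1, S.one_mem, C, hC, by simp⟩

theorem conj_mem_conjSpan {g M : Matrix (Fin N) (Fin N) ℂ} (hg : g ∈ S) (hM : M ∈ conjSpan S D) :
    g * M * star g ∈ conjSpan S D := by
  induction hM using Submodule.span_induction with
  | mem M hM =>
    obtain ⟨h, hh, C, hC, rfl⟩ := hM
    exact Submodule.subset_span ⟨g * h, S.mul_mem hg hh, C, hC, by simp only [star_mul, mul_assoc]⟩
  | zero => simp
  | add M M' _ _ h h' =>
    rw [mul_add, add_mul]
    exact Submodule.add_mem _ h h'
  | smul r M _ h =>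
    rw [mul_smul_comm, smul_mul_assoc]
    exact Submodule.smul_mem _ r h

/-- The elements of `V` whose commutators with `V` lie in `V`. -/
def bracketStabilizer (V : Submodule ℝ (Matrix (Fin N) (Fin N) ℂ)) :
    Submodule ℝ (Matrix (Fin N) (Fin N) ℂ) where
  carrier := {X | X ∈ V ∧ ∀ Y ∈ V, X * Y - Y * X ∈ V}
  add_mem' := by
    rintro X X' ⟨hX, h⟩ ⟨hX', h'⟩
    refine ⟨V.add_mem hX hX', fun Y hY => ?_⟩
    convert V.add_mem (h Y hY) (h' Y hY) using 1
    noncomm_ring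
  zero_mem' := by simp
  smul_mem' := by
    rintro c X ⟨hX, h⟩
    refine ⟨V.smul_mem c hX, fun Y hY => ?_⟩
    rw [smul_mul_assoc, mul_smul_comm, ← smul_sub]
    exact V.smul_mem c (h Y hY)

/-- This is the Jacobi identity. -/
theorem bracketClosed_bracketStabilizer (V : Submodule ℝ (Matrix (Fin N) (Fin N) ℂ)) :
    BracketClosed (bracketStabilizer V) := by
  rintro X ⟨hX, h⟩ Y ⟨hY, h'⟩
  refine ⟨h Y hY, fun Z hZ => ?_⟩
  convert V.sub_mem (h _ (h' Z hZ)) (h' _ (h Z hZ)) using 1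
  noncomm_ring

open scoped Matrix.Norms.L2Operator

theorem star_exp_of_mem_suAlgebra {X : Matrix (Fin N) (Fin N) ℂ} (hX : X ∈ suAlgebra N) :
    star (NormedSpace.exp X) = NormedSpace.exp (-X) := by
  rw [star_eq_conjTranspose, ← exp_conjTranspose, hX.1]

/-- The bracket is the derivative at 0 of conjugation by exp(tC). A right derivative is enough, so
only t ≥ 0 is needed, and a finite-dimensional subspace contains its limits. -/
theorem commutator_mem_conjSpan (hD : D ⊆ suAlgebra N)
    (hS : ∀ C ∈ D, ∀ t : ℝ, 0 ≤ t → NormedSpace.exp (t • C) ∈ S)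
    {C M : Matrix (Fin N) (Fin N) ℂ} (hC : C ∈ D) (hM : M ∈ conjSpan S D) :
    C * M - M * C ∈ conjSpan S D := by
  have h1 : HasDerivAt (fun t : ℝ => NormedSpace.exp (t • C) * M * NormedSpace.exp (t • (-C)))
      (C * M - M * C) 0 := by
    have h := ((hasDerivAt_exp_smul_const C (0 : ℝ)).mul_const M).mul
      (hasDerivAt_exp_smul_const (-C) (0 : ℝ))
    refine h.congr_deriv ?_
    simp [sub_eq_add_neg]
  have h2 := h1.tendsto_slope_zero_right
  refine (Submodule.closed_of_finiteDimensional (conjSpan S D)).mem_of_tendsto h2 ?_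
  filter_upwards [self_mem_nhdsWithin] with t ht
  refine Submodule.smul_mem _ _ (Submodule.sub_mem _ ?_ ?_)
  · rw [zero_add, smul_neg, ← star_exp_of_mem_suAlgebra (Submodule.smul_mem _ t (hD hC))]
    exact conj_mem_conjSpan (hS C hC t (le_of_lt ht)) hM
  · simpa using hM

theorem suAlgebra_le_conjSpan {E : Fin N → ℝ} {B : Matrix (Fin N) (Fin N) ℂ}
    (hB : Bᴴ = -B) (hG : GraphConnected (regularPart E B))
    (hD : Set.range (fun u : ℝ => drift E + u • B) ⊆ suAlgebra N)
    (hS : ∀ C ∈ Set.range (fun u : ℝ => drift E + u • B), ∀ t : ℝ, 0 ≤ t →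
      NormedSpace.exp (t • C) ∈ S) :
    suAlgebra N ≤ conjSpan S (Set.range fun u : ℝ => drift E + u • B) := by
  set D := Set.range (fun u : ℝ => drift E + u • B) with hDdef
  have h0 : ∀ u : ℝ, drift E + u • B ∈ bracketStabilizer (conjSpan S D) := fun u =>
    ⟨subset_conjSpan ⟨u, rfl⟩, fun Y hY => commutator_mem_conjSpan hD hS ⟨u, rfl⟩ hY⟩
  have hA : drift E ∈ bracketStabilizer (conjSpan S D) := by simpa using h0 0
  have hB' : B ∈ bracketStabilizer (conjSpan S D) := by
    simpa using Submodule.sub_mem _ (h0 1) hA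
  exact (suAlgebra_le (bracketClosed_bracketStabilizer _) hA hB' hB hG).trans fun X hX => hX.1

end Orbit

end QuantumControl

/-! ### Concatenation of controls -/

namespace QuantumControl

open Matrix Filter Topology

section Reachable

open scoped Matrix.Norms.L2Operator

variable {N : ℕ} {A B : Matrix (Fin N) (Fin N) ℂ}

theorem one_mem_reachableSet : (1 : specialUnitaryGroup (Fin N) ℂ) ∈ reachableSet A B :=
  ⟨0, le_rfl, fun _ => 0, ⟨∅, fun _ _ _ => Eventually.of_forall fun _ => rfl⟩, fun _ => 1,
    ⟨rfl, continuousOn_const, ∅, fun _ ht => absurd (ht.1.trans ht.2) (lt_irrefl _)⟩, rfl⟩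

theorem exp_mul_mem_reachableSet {v : ℝ} (hC : A + v • B ∈ suAlgebra N) {t : ℝ} (ht : 0 ≤ t)
    {Z : specialUnitaryGroup (Fin N) ℂ} (hZ : Z ∈ reachableSet A B) :
    (⟨NormedSpace.exp (t • (A + v • B)),
      exp_mem_specialUnitaryGroup (Submodule.smul_mem _ t hC)⟩ * Z) ∈ reachableSet A B := by
  classical
  obtain ⟨T, hT, u, ⟨s₁, hs₁⟩, X, ⟨hX0, hXc, s₂, hs₂⟩, rfl⟩ := hZ
  set C := A + v • B with hCdef
  let e : ℝ → specialUnitaryGroup (Fin N) ℂ := fun r =>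
    ⟨NormedSpace.exp (r • C), exp_mem_specialUnitaryGroup (Submodule.smul_mem _ r hC)⟩
  have he : Continuous e := by
    refine Continuous.subtype_mk ?_ _
    have : NormedAlgebra ℚ (Matrix (Fin N) (Fin N) ℂ) := .restrictScalars ℚ ℂ _
    exact NormedSpace.exp_continuous.comp (continuous_id.smul continuous_const)
  have he0 : e 0 = 1 := by
    refine Subtype.ext ?_
    change NormedSpace.exp ((0 : ℝ) • C) = 1
    rw [zero_smul, NormedSpace.exp_zero]
  let w : ℝ → ℝ := fun s => if s < T then u s else v
  have hw₁ : ∀ s < T, w =ᶠ[𝓝 s] u := fun s hs => by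
    filter_upwards [Iio_mem_nhds hs] with r hr using if_pos hr
  have hw₂ : ∀ s > T, w =ᶠ[𝓝 s] fun _ => v := fun s hs => by
    filter_upwards [Ioi_mem_nhds hs] with r hr using if_neg (not_lt_of_gt hr)
  -- Follow X up to time T, then the constant control v; the truncations give one continuous
  -- formula.
  let Y : ℝ → specialUnitaryGroup (Fin N) ℂ := fun s => e (max (s - T) 0) * X (min s T)
  refine ⟨T + t, add_nonneg hT ht, w, ⟨insert T s₁, ?_⟩, Y, ⟨?_, ?_, insert T s₂, ?_⟩, ?_⟩
  · intro s hs hsS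
    rw [Finset.mem_insert, not_or] at hsS
    rcases lt_or_gt_of_ne hsS.1 with h | h
    · filter_upwards [hw₁ s h, hs₁ s ⟨hs.1, h⟩ hsS.2] with r hr hr'
      rw [hr, hr', (hw₁ s h).eq_of_nhds]
    · filter_upwards [hw₂ s h] with r hr
      rw [hr, (hw₂ s h).eq_of_nhds]
  · change e (max (0 - T) 0) * X (min 0 T) = 1
    rw [max_eq_right (by linarith), min_eq_left hT, he0, hX0, one_mul]
  · refine (he.comp (by fun_prop)).continuousOn.mul (hXc.comp (by fun_prop) ?_)
    intro s hs
    exact ⟨le_min hs.1 hT, min_le_right _ _⟩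
  · intro s hs hsS
    rw [Finset.mem_insert, not_or] at hsS
    rcases lt_or_gt_of_ne hsS.1 with h | h
    · have hY : Y =ᶠ[𝓝 s] X := by
        filter_upwards [Iio_mem_nhds h] with r hr
        have hr : r < T := hr
        change e (max (r - T) 0) * X (min r T) = X r
        rw [max_eq_right (by linarith), min_eq_left hr.le, he0, one_mul]
      rw [(hw₁ s h).eq_of_nhds, hY.eq_of_nhds]
      refine (hs₂ s ⟨hs.1, h⟩ hsS.2).congr_of_eventuallyEq ?_
      exact hY.fun_comp _
    · have hY : Y =ᶠ[𝓝 s] fun r => e (r - T) * X T := by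
        filter_upwards [Ioi_mem_nhds h] with r hr
        have hr : T < r := hr
        change e (max (r - T) 0) * X (min r T) = _
        rw [max_eq_left (by linarith), min_eq_right hr.le]
      rw [(hw₂ s h).eq_of_nhds, hY.eq_of_nhds, ← hCdef]
      have h1 : HasDerivAt (fun r : ℝ => NormedSpace.exp ((r - T) • C) *
          (X T : Matrix (Fin N) (Fin N) ℂ))
          (C * NormedSpace.exp ((s - T) • C) * (X T : Matrix (Fin N) (Fin N) ℂ)) s :=
        (HasDerivAt.comp_sub_const s T (hasDerivAt_exp_smul_const' C (s - T))).mul_const _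
      rw [mul_assoc] at h1
      refine h1.congr_of_eventuallyEq ?_
      exact hY.fun_comp _
  · change e (max (T + t - T) 0) * X (min (T + t) T) = _
    rw [add_sub_cancel_left, max_eq_left ht, min_eq_right (by linarith)]

end Reachable

end QuantumControl

/-! ### An interior point of the flow monoid -/

namespace QuantumControl

open Matrix Filter Topology

section Interior

open scoped Matrix.Norms.L2Operator

variable {N : ℕ} {S : Submonoid (Matrix (Fin N) (Fin N) ℂ)} {D : Set (Matrix (Fin N) (Fin N) ℂ)}

/-- Some map into `S` that is strictly differentiable at the origin has rank `n` there. -/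
def HasMapOfRank (S : Submonoid (Matrix (Fin N) (Fin N) ℂ)) (n : ℕ) : Prop :=
  ∃ (V : Type) (_ : NormedAddCommGroup V) (_ : NormedSpace ℝ V) (_ : CompleteSpace V)
    (F : V → Matrix (Fin N) (Fin N) ℂ) (F' : V →L[ℝ] Matrix (Fin N) (Fin N) ℂ),
    HasStrictFDerivAt F F' 0 ∧ (∀ᶠ t in 𝓝 0, F t ∈ S) ∧ Module.finrank ℝ F'.range = n

theorem hasMapOfRank_zero : HasMapOfRank S 0 :=
  ⟨ℝ, inferInstance, inferInstance, inferInstance, fun _ => 1, 0, hasStrictFDerivAt_const _ _,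
    Eventually.of_forall fun _ => S.one_mem, by
      rw [show (0 : ℝ →L[ℝ] Matrix (Fin N) (Fin N) ℂ).range = ⊥ from LinearMap.range_zero,
        finrank_bot]⟩

/-- If the rank of a map into `S` is not full, then multiplying the map by a further flow
increases it. -/
theorem HasMapOfRank.exists_lt (hSU : S ≤ specialUnitaryGroup (Fin N) ℂ)
    (hS : ∀ C ∈ D, ∀ t : ℝ, 0 ≤ t → NormedSpace.exp (t • C) ∈ S)
    (hspan : suAlgebra N ≤ conjSpan S D)
    {V : Type} [NormedAddCommGroup V] [NormedSpace ℝ V] [CompleteSpace V]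
    {F : V → Matrix (Fin N) (Fin N) ℂ} {F' : V →L[ℝ] Matrix (Fin N) (Fin N) ℂ}
    (hF : HasStrictFDerivAt F F' 0) (hFS : ∀ᶠ t in 𝓝 0, F t ∈ S)
    {M : Matrix (Fin N) (Fin N) ℂ} (hM : M ∈ suAlgebra N) (hMF : F 0 * M ∉ F'.range) :
    ∃ n > Module.finrank ℝ F'.range, HasMapOfRank S n := by
  -- Conjugates g C g* span su(N), so one of them is already missed. The new map is F(x) g exp((1 +
  -- r)C).
  obtain ⟨g, hg, C, hC, hgC⟩ : ∃ g ∈ S, ∃ C ∈ D, F 0 * (g * C * star g) ∉ F'.range := by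
    by_contra! h
    have h1 : conjSpan S D ≤ Submodule.comap (LinearMap.mulLeft ℝ (F 0)) F'.range := by
      refine Submodule.span_le.2 ?_
      rintro _ ⟨g, hg, C, hC, rfl⟩
      exact h g hg C hC
    exact hMF (h1 (hspan hM))
  -- The base time is 1, so that all nearby times are positive and the flow stays in S.
  have hexp : HasStrictDerivAt (fun r : ℝ => NormedSpace.exp (r • C))
      (C * NormedSpace.exp C) 1 := by
    simpa using hasStrictDerivAt_exp_smul_const' C (1 : ℝ)
  have hr : HasStrictFDerivAt (fun p : V × ℝ => 1 + p.2) (ContinuousLinearMap.snd ℝ V ℝ) 0 :=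
    hasStrictFDerivAt_snd.const_add 1
  have h1 : HasStrictFDerivAt (fun p : V × ℝ => NormedSpace.exp ((1 + p.2) • C))
      ((ContinuousLinearMap.toSpanSingleton ℝ (C * NormedSpace.exp C)).comp
        (ContinuousLinearMap.snd ℝ V ℝ)) 0 := by
    refine HasStrictFDerivAt.comp (g := fun r : ℝ => NormedSpace.exp (r • C)) 0 ?_ hr
    simpa using hexp.hasStrictFDerivAt
  have h2 : HasStrictFDerivAt (fun p : V × ℝ => F p.1 * g)
      (((ContinuousLinearMap.mul ℝ (Matrix (Fin N) (Fin N) ℂ)).flip g).comp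
        (F'.comp (ContinuousLinearMap.fst ℝ V ℝ))) 0 := by
    refine HasStrictFDerivAt.comp (g := fun X => X * g) 0
      (((ContinuousLinearMap.mul ℝ (Matrix (Fin N) (Fin N) ℂ)).flip g).hasStrictFDerivAt) ?_
    exact HasStrictFDerivAt.comp (g := F) 0 hF hasStrictFDerivAt_fst
  have h3 := h2.mul' h1
  refine ⟨_, ?_, V × ℝ, inferInstance, inferInstance, inferInstance, _, _, h3, ?_, rfl⟩
  · set w := F 0 * (g * C * star g) with hw
    have hgu : star g * g = 1 :=
      mem_unitaryGroup_iff'.1 (mem_specialUnitaryGroup_iff.1 (hSU hg)).1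
    have hunit : IsUnit (g * NormedSpace.exp C) := by
      have : NormedAlgebra ℚ (Matrix (Fin N) (Fin N) ℂ) := .restrictScalars ℚ ℂ _
      exact (IsUnit.of_mul_eq_one_right _ hgu).mul (NormedSpace.isUnit_exp C)
    -- The new differential is (e, r) ↦ (F'e + r w) g exp(C); the invertible right factor preserves
    -- rank.
    have hinj : Function.Injective (LinearMap.mulRight ℝ (g * NormedSpace.exp C)) :=
      fun X Y h => hunit.mul_left_injective h
    have hlt : F'.range < F'.range ⊔ Submodule.span ℝ {w} :=
      left_lt_sup.2 fun h => hgC (h (Submodule.mem_span_singleton_self w))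
    refine (Submodule.finrank_lt_finrank_of_lt hlt).trans_le ?_
    rw [(Submodule.equivMapOfInjective _ hinj _).finrank_eq]
    refine Submodule.finrank_mono ?_
    rw [Submodule.map_sup, sup_le_iff, Submodule.map_span_le]
    refine ⟨?_, ?_⟩
    · rintro _ ⟨_, ⟨e, rfl⟩, rfl⟩
      refine ⟨(e, 0), ?_⟩
      simp [mul_assoc]
    · rintro _ rfl
      refine ⟨(0, 1), ?_⟩
      have h6 : w * (g * NormedSpace.exp C) = F 0 * g * (C * NormedSpace.exp C) := by
        rw [hw]
        simp only [mul_assoc]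
        rw [← mul_assoc (star g), hgu, one_mul]
      simpa [mul_assoc] using h6.symm
  · have h4 : ∀ᶠ p : V × ℝ in 𝓝 0, F p.1 ∈ S := continuous_fst.tendsto (0 : V × ℝ) hFS
    have h5 : ∀ᶠ p : V × ℝ in 𝓝 0, 0 < 1 + p.2 := by
      have : Continuous fun p : V × ℝ => 1 + p.2 := by fun_prop
      exact this.tendsto (0 : V × ℝ) (Ioi_mem_nhds (by simp))
    filter_upwards [h4, h5] with p hp hp'
    exact S.mul_mem (S.mul_mem hp hg) (hS C hC _ hp'.le)

/-- Otherwise the rank could be raised forever, past the dimension of the matrix space. -/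
theorem exists_map_range_ge (hSU : S ≤ specialUnitaryGroup (Fin N) ℂ)
    (hS : ∀ C ∈ D, ∀ t : ℝ, 0 ≤ t → NormedSpace.exp (t • C) ∈ S)
    (hspan : suAlgebra N ≤ conjSpan S D) :
    ∃ (V : Type) (_ : NormedAddCommGroup V) (_ : NormedSpace ℝ V) (_ : CompleteSpace V)
      (F : V → Matrix (Fin N) (Fin N) ℂ) (F' : V →L[ℝ] Matrix (Fin N) (Fin N) ℂ),
      HasStrictFDerivAt F F' 0 ∧ (∀ᶠ t in 𝓝 0, F t ∈ S) ∧
        ∀ M ∈ suAlgebra N, F 0 * M ∈ F'.range := by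
  by_contra! hcon
  have h : ∀ n, ∃ m ≥ n, HasMapOfRank S m := by
    intro n
    induction n with
    | zero => exact ⟨0, le_rfl, hasMapOfRank_zero⟩
    | succ n ih =>
      obtain ⟨m, hm, V, i₁, i₂, i₃, F, F', hF, hFS, rfl⟩ := ih
      obtain ⟨M, hM, hMF⟩ := hcon V i₁ i₂ i₃ F F' hF hFS
      obtain ⟨k, hk, hk'⟩ := HasMapOfRank.exists_lt hSU hS hspan hF hFS hM hMF
      exact ⟨k, by omega, hk'⟩
  obtain ⟨m, hm, V, i₁, i₂, i₃, F, F', hF, hFS, rfl⟩ :=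
    h (Module.finrank ℝ (Matrix (Fin N) (Fin N) ℂ) + 1)
  have := Submodule.finrank_le F'.range
  omega

theorem exists_injOn_exp_nhds : ∃ s ∈ 𝓝 (0 : Matrix (Fin N) (Fin N) ℂ),
    Set.InjOn NormedSpace.exp s := by
  have h : HasStrictFDerivAt (NormedSpace.exp : Matrix (Fin N) (Fin N) ℂ → _)
      ((ContinuousLinearEquiv.refl ℝ (Matrix (Fin N) (Fin N) ℂ) :
        Matrix (Fin N) (Fin N) ℂ ≃L[ℝ] Matrix (Fin N) (Fin N) ℂ) :
        Matrix (Fin N) (Fin N) ℂ →L[ℝ] Matrix (Fin N) (Fin N) ℂ) 0 :=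
    hasStrictFDerivAt_exp_zero
  exact ⟨_, (h.toOpenPartialHomeomorph _).open_source.mem_nhds h.mem_toOpenPartialHomeomorph_source,
    (h.toOpenPartialHomeomorph _).injOn⟩

/-- The map `(H, θ) ↦ H + Hᴴ + iθ` onto the complement of `su(N)`. -/
noncomputable def complementMap (N : ℕ) :
    Matrix (Fin N) (Fin N) ℂ × ℝ →L[ℝ] Matrix (Fin N) (Fin N) ℂ :=
  (ContinuousLinearMap.id ℝ _ + ((starL' ℝ : Matrix (Fin N) (Fin N) ℂ ≃L[ℝ] _) :
    Matrix (Fin N) (Fin N) ℂ →L[ℝ] Matrix (Fin N) (Fin N) ℂ)).comp (ContinuousLinearMap.fst ℝ _ _) +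
  (ContinuousLinearMap.toSpanSingleton ℝ (Complex.I • (1 : Matrix (Fin N) (Fin N) ℂ))).comp
    (ContinuousLinearMap.snd ℝ _ _)

theorem complementMap_apply (p : Matrix (Fin N) (Fin N) ℂ × ℝ) :
    complementMap N p = p.1 + star p.1 + p.2 • (Complex.I • (1 : Matrix (Fin N) (Fin N) ℂ)) := rfl

theorem star_complementMap (p : Matrix (Fin N) (Fin N) ℂ × ℝ) :
    star (complementMap N p) =
      p.1 + star p.1 - p.2 • (Complex.I • (1 : Matrix (Fin N) (Fin N) ℂ)) := by
  rw [complementMap_apply, star_add, star_add, star_star, star_smul, star_smul, star_one]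
  simp [sub_eq_add_neg, add_comm]

/-- Near the origin only the zero matrix of the complement of `su(N)` has its exponential in
`SU(N)`. -/
theorem eventually_complementMap_eq_zero [Nonempty (Fin N)] :
    ∀ᶠ p in 𝓝 (0 : Matrix (Fin N) (Fin N) ℂ × ℝ),
      NormedSpace.exp (complementMap N p) ∈ specialUnitaryGroup (Fin N) ℂ →
        complementMap N p = 0 := by
  obtain ⟨s, hs, hinj⟩ := exists_injOn_exp_nhds (N := N)
  have h1 : ∀ᶠ p in 𝓝 (0 : Matrix (Fin N) (Fin N) ℂ × ℝ), -complementMap N p ∈ s := by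
    have : Continuous fun p => -complementMap N p := by fun_prop
    exact this.tendsto _ (by simpa using hs)
  have h2 : ∀ᶠ p in 𝓝 (0 : Matrix (Fin N) (Fin N) ℂ × ℝ), star (complementMap N p) ∈ s := by
    have : Continuous fun p => star (complementMap N p) := by fun_prop
    exact this.tendsto _ (by simpa using hs)
  have h3 : ∀ᶠ p in 𝓝 (0 : Matrix (Fin N) (Fin N) ℂ × ℝ), |p.2 * (N : ℝ)| < 2 * Real.pi := by
    have : Continuous fun p : Matrix (Fin N) (Fin N) ℂ × ℝ => |p.2 * (N : ℝ)| := by fun_prop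
    exact this.tendsto _ (Iio_mem_nhds (by simp [Real.pi_pos]))
  filter_upwards [h1, h2, h3] with p hp1 hp2 hp3 hK
  set K := complementMap N p with hKdef
  obtain ⟨hU, hdet⟩ := mem_specialUnitaryGroup_iff.1 hK
  have : NormedAlgebra ℚ (Matrix (Fin N) (Fin N) ℂ) := .restrictScalars ℚ ℂ _
  have h4 : star K = -K := by
    -- Both exponentials are the inverse of the unitary exp K.
    refine hinj hp2 hp1 ?_
    have h5 : star (NormedSpace.exp K) * NormedSpace.exp K = 1 := mem_unitaryGroup_iff'.1 hU
    have h6 : NormedSpace.exp K * NormedSpace.exp (-K) = 1 := by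
      rw [← NormedSpace.exp_add_of_commute (Commute.refl K).neg_right, add_neg_cancel,
        NormedSpace.exp_zero]
    rw [star_eq_conjTranspose, exp_conjTranspose, ← star_eq_conjTranspose]
    exact left_inv_eq_right_inv h5 h6
  have h7 : p.1 + star p.1 = 0 := by
    rw [hKdef, star_complementMap, complementMap_apply] at h4
    have h8 : (2 : ℝ) • (p.1 + star p.1) = 0 := by
      rw [two_smul]
      nth_rewrite 1 [← sub_add_cancel (p.1 + star p.1) (p.2 • (Complex.I • 1))]
      rw [h4]
      abel
    exact (smul_eq_zero.1 h8).resolve_left two_ne_zero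
  have hK' : K = p.2 • (Complex.I • (1 : Matrix (Fin N) (Fin N) ℂ)) := by
    rw [hKdef, complementMap_apply, h7, zero_add]
  -- What remains is K = iθ; determinant 1 puts Nθ in 2πℤ, and the bound |θN| < 2π leaves only θ =
  -- 0.
  rw [det_exp_of_skewHermitian h4, Complex.exp_eq_one_iff] at hdet
  obtain ⟨n, hn⟩ := hdet
  have h9 : p.2 * (N : ℝ) = n * (2 * Real.pi) := by
    rw [hK', trace_smul, trace_smul, trace_one, Fintype.card_fin] at hn
    have := congrArg Complex.im hn
    simpa using this
  have h10 : n = 0 := by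
    rw [h9, abs_mul, abs_of_pos Real.two_pi_pos] at hp3
    have h11 : |(n : ℝ)| < 1 := by
      by_contra! h
      nlinarith [Real.two_pi_pos]
    exact Int.abs_lt_one_iff.1 (by exact_mod_cast h11)
  have h12 : p.2 = 0 := by
    rw [h10] at h9
    have hN : (N : ℝ) ≠ 0 := by
      have := Fin.pos_iff_nonempty.2 ‹Nonempty (Fin N)›
      positivity
    simpa [hN] using h9
  rw [hK', h12, zero_smul]

theorem exists_suAlgebra_add_complementMap [Nonempty (Fin N)] (Y : Matrix (Fin N) (Fin N) ℂ) :
    ∃ Z ∈ suAlgebra N, ∃ p, Y = Z + complementMap N p := by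
  set θ : ℝ := (((1 / 2 : ℝ) • (Y - star Y)).trace).im / N with hθ
  refine ⟨(1 / 2 : ℝ) • (Y - star Y) - θ • (Complex.I • (1 : Matrix (Fin N) (Fin N) ℂ)), ⟨?_, ?_⟩,
    ((1 / 4 : ℝ) • (Y + star Y), θ), ?_⟩
  · rw [← star_eq_conjTranspose, star_sub, star_smul, star_sub, star_star, star_smul, star_smul,
      star_one]
    simp only [star_trivial, Complex.star_def, Complex.conj_I, neg_smul]
    module
  · have hN : (N : ℝ) ≠ 0 := by
      have := Fin.pos_iff_nonempty.2 ‹Nonempty (Fin N)›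
      positivity
    have h1 : θ * (N : ℝ) = (((1 / 2 : ℝ) • (Y - star Y)).trace).im := div_mul_cancel₀ _ hN
    rw [trace_sub, trace_smul θ, trace_smul Complex.I, trace_one, Fintype.card_fin]
    apply Complex.ext
    · simp [star_eq_conjTranspose, trace_conjTranspose]
    · rw [Complex.sub_im, ← h1]
      simp
  · rw [complementMap_apply, star_smul, star_add, star_star, star_trivial (1 / 4 : ℝ)]
    module

/-- Appending the factor exp of the complement to a map of maximal rank gives a submersion into all
matrices, hence one that is open at the origin. Where its value lies in SU(N), the extra factor does
too, so near the origin it is 1 and the value lies in S. -/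
theorem exists_mem_nhds_of_suAlgebra_le [Nonempty (Fin N)]
    (hSU : S ≤ specialUnitaryGroup (Fin N) ℂ)
    (hS : ∀ C ∈ D, ∀ t : ℝ, 0 ≤ t → NormedSpace.exp (t • C) ∈ S)
    (hspan : suAlgebra N ≤ conjSpan S D) :
    ∃ g : specialUnitaryGroup (Fin N) ℂ,
      (S.comap (specialUnitaryGroup (Fin N) ℂ).subtype : Set (specialUnitaryGroup (Fin N) ℂ)) ∈
        𝓝 g := by
  obtain ⟨V, _, _, _, F, F', hF, hFS, hF'⟩ := exists_map_range_ge hSU hS hspan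
  have h0 : F 0 ∈ specialUnitaryGroup (Fin N) ℂ := hSU hFS.self_of_nhds
  refine ⟨⟨F 0, h0⟩, ?_⟩
  have h1 : HasStrictFDerivAt (fun p : V × (Matrix (Fin N) (Fin N) ℂ × ℝ) => F p.1)
      (F'.comp (ContinuousLinearMap.fst ℝ _ _)) 0 :=
    HasStrictFDerivAt.comp (g := F) 0 hF hasStrictFDerivAt_fst
  have h2 : HasStrictFDerivAt
      (fun p : V × (Matrix (Fin N) (Fin N) ℂ × ℝ) => NormedSpace.exp (complementMap N p.2))
      ((complementMap N).comp (ContinuousLinearMap.snd ℝ _ _)) 0 := by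
    refine HasStrictFDerivAt.comp (g := NormedSpace.exp)
      (g' := ContinuousLinearMap.id ℝ (Matrix (Fin N) (Fin N) ℂ)) 0 ?_
      ((complementMap N).comp (ContinuousLinearMap.snd ℝ V _)).hasStrictFDerivAt
    rw [map_zero]
    exact hasStrictFDerivAt_exp_zero
  have h3 := h1.mul' h2
  have h4 := h3.map_nhds_eq_of_surj (by
    refine LinearMap.range_eq_top.2 fun X => ?_
    obtain ⟨Z, hZ, p, hp⟩ := exists_suAlgebra_add_complementMap (star (F 0) * X)
    obtain ⟨e, he⟩ := hF' Z hZ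
    refine ⟨(e, p), ?_⟩
    have he : F' e = F 0 * Z := he
    have h5 : F 0 * (star (F 0) * X) = X := by
      rw [← mul_assoc, mem_unitaryGroup_iff.1 (mem_specialUnitaryGroup_iff.1 h0).1, one_mul]
    rw [← h5, hp, mul_add]
    simp [he, add_comm])
  have h5 : ∀ᶠ p : V × (Matrix (Fin N) (Fin N) ℂ × ℝ) in 𝓝 0, F p.1 ∈ S :=
    continuous_fst.tendsto (0 : V × (Matrix (Fin N) (Fin N) ℂ × ℝ)) hFS
  have h6 : ∀ᶠ p : V × (Matrix (Fin N) (Fin N) ℂ × ℝ) in 𝓝 0,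
      NormedSpace.exp (complementMap N p.2) ∈ specialUnitaryGroup (Fin N) ℂ →
        complementMap N p.2 = 0 :=
    continuous_snd.tendsto (0 : V × (Matrix (Fin N) (Fin N) ℂ × ℝ)) eventually_complementMap_eq_zero
  have h7 : ∀ᶠ M in 𝓝 (F 0), M ∈ specialUnitaryGroup (Fin N) ℂ → M ∈ S := by
    have h8 : F 0 = ((fun p : V × (Matrix (Fin N) (Fin N) ℂ × ℝ) => F p.1) *
      (fun p : V × (Matrix (Fin N) (Fin N) ℂ × ℝ) => NormedSpace.exp (complementMap N p.2))) 0 := by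
      simp
    rw [h8, ← h4, eventually_map]
    filter_upwards [h5, h6] with p hp hp' hg
    change F p.1 * NormedSpace.exp (complementMap N p.2) ∈ specialUnitaryGroup (Fin N) ℂ at hg
    change F p.1 * NormedSpace.exp (complementMap N p.2) ∈ S
    have h9 : NormedSpace.exp (complementMap N p.2) ∈ specialUnitaryGroup (Fin N) ℂ := by
      have h10 : star (F p.1) * (F p.1 * NormedSpace.exp (complementMap N p.2)) ∈
          specialUnitaryGroup (Fin N) ℂ :=
        mul_mem (star (⟨F p.1, hSU hp⟩ : specialUnitaryGroup (Fin N) ℂ)).2 hg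
      rwa [← mul_assoc, mem_unitaryGroup_iff'.1 (mem_specialUnitaryGroup_iff.1 (hSU hp)).1,
        one_mul] at h10
    rw [hp' h9, NormedSpace.exp_zero, mul_one]
    exact hp
  have h11 := (continuous_subtype_val (p := fun M => M ∈ specialUnitaryGroup (Fin N) ℂ)).tendsto
    ⟨F 0, h0⟩ h7
  filter_upwards [h11] with g hg using hg g.2

end Interior

end QuantumControl

/-! ### The flow monoid and controllability -/

namespace QuantumControl

open Matrix

/-- The monoid generated by the flows of the fields `A + u B` in positive time. -/
noncomputable def flowMonoid {N : ℕ} (A B : Matrix (Fin N) (Fin N) ℂ) :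
    Submonoid (Matrix (Fin N) (Fin N) ℂ) :=
  Submonoid.closure {M | ∃ u t : ℝ, 0 ≤ t ∧ M = NormedSpace.exp (t • (A + u • B))}

variable {N : ℕ} {A B : Matrix (Fin N) (Fin N) ℂ}

theorem flowMonoid_le (hAB : ∀ u : ℝ, A + u • B ∈ suAlgebra N) :
    flowMonoid A B ≤ specialUnitaryGroup (Fin N) ℂ := by
  refine Submonoid.closure_le.2 ?_
  rintro _ ⟨u, t, _, rfl⟩
  exact exp_mem_specialUnitaryGroup (Submodule.smul_mem _ t (hAB u))

theorem mem_reachableSet_of_mem_flowMonoid (hAB : ∀ u : ℝ, A + u • B ∈ suAlgebra N)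
    {M : Matrix (Fin N) (Fin N) ℂ} (hM : M ∈ flowMonoid A B) :
    ∃ Z ∈ reachableSet A B, (Z : Matrix (Fin N) (Fin N) ℂ) = M := by
  -- Later flows multiply on the left, hence the left induction.
  induction hM using Submonoid.closure_induction_left with
  | one => exact ⟨1, one_mem_reachableSet, rfl⟩
  | mul_left X hX Y _ ih =>
    obtain ⟨u, t, ht, rfl⟩ := hX
    obtain ⟨Z, hZ, rfl⟩ := ih
    exact ⟨_, exp_mul_mem_reachableSet (hAB u) ht hZ, rfl⟩

end QuantumControl

theorem mainTheorem4 (N : ℕ) (E : Fin N → ℝ) (hE : Monotone E) (hE_trace : ∑ i, E i = 0)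
    (B : Matrix (Fin N) (Fin N) ℂ) (hB : B.conjTranspose = -B) (hB_trace : B.trace = 0)
    (hG : QuantumControl.GraphConnected B)
    (hGr : QuantumControl.GraphConnected (QuantumControl.regularPart E B)) :
    QuantumControl.Controllable (QuantumControl.drift E) B := by
  open QuantumControl in
  have hAB : ∀ u : ℝ, drift E + u • B ∈ suAlgebra N := fun u =>
    Submodule.add_mem _ (drift_mem_suAlgebra hE_trace) (Submodule.smul_mem _ u ⟨hB, hB_trace⟩)
  have hD : Set.range (fun u : ℝ => drift E + u • B) ⊆ suAlgebra N := by
    rintro _ ⟨u, rfl⟩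
    exact hAB u
  have hS : ∀ C ∈ Set.range (fun u : ℝ => drift E + u • B), ∀ t : ℝ, 0 ≤ t →
      NormedSpace.exp (t • C) ∈ flowMonoid (drift E) B := by
    rintro _ ⟨u, rfl⟩ t ht
    exact Submonoid.subset_closure ⟨u, t, ht, rfl⟩
  have : Nonempty (Fin N) := hG.nonempty
  obtain ⟨g, hg⟩ := exists_mem_nhds_of_suAlgebra_le (flowMonoid_le hAB) hS
    (suAlgebra_le_conjSpan hB hGr hD hS)
  have htop := submonoid_eq_top_of_mem_nhds hg
  refine Set.eq_univ_of_forall fun X => ?_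
  have hX : X ∈ (flowMonoid (drift E) B).comap (Matrix.specialUnitaryGroup (Fin N) ℂ).subtype :=
    htop ▸ Submonoid.mem_top X
  obtain ⟨Z, hZ, hZX⟩ := mem_reachableSet_of_mem_flowMonoid hAB hX
  rwa [← Subtype.ext hZX]
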